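/- Let $L$ be a first-order language and let $\mathcal U$ be a saturated $L$-structure whose cardinality $\kappa$ is (uncountable, strongly) inaccessible and larger than $|L|$. Let $z$ be a finite tuple of variables and let $\mathcal D\subseteq\mathcal U^{|z|}$ be an arbitrary set. For an $L$-formula $\varphi(x,z)$ without parameters ($x$ a finite tuple), $b\in\mathcal U^{|x|}$ and $B\subseteq\mathcal U$, write $\varphi(b,\mathcal U)=\{a\in\mathcal U^{|z|}:\mathcal U\models\varphi(b,a)\}$ and $\varphi(b,B)=\varphi(b,\mathcal U)\cap B^{|z|}$. We say that $\mathcal D$ is *approximable by* $\varphi(x,z)$ if for every finite $B\subseteq\mathcal U$ there is $b\in\mathcal U^{|x|}$ such that $\varphi(b,B)=\mathcal D\cap B^{|z|}$, and that $\mathcal D$ is *approximable from below by* $\varphi(x,z)$ if for every finite $B\subseteq\mathcal U$ there is $b\in\mathcal U^{|x|}$ such that $\varphi(b,B)=\mathcal D\cap B^{|z|}$ and $\varphi(b,\mathcal U)\subseteq\mathcal D$. We say that $\mathcal D$ is *approximable from below* if it is so by some $L$-formula. The formula $\varphi(x,z)$ is *NIP* if the family $\{\varphi(a,\mathcal U):a\in\mathcal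 U^{|x|}\}$ has finite VC-dimension, that is, if there is $d<\omega$ such that for no set $S\subseteq\mathcal U^{|z|}$ of size $d$ is every subset of $S$ of the form $\varphi(a,\mathcal U)\cap S$ with $a\in\mathcal U^{|x|}$. **Corollary.** If $\mathcal D$ is approximable by some NIP formula $\varphi(x,z)$, then $\mathcal D$ is approximable from below, that is, there is an $L$-formula $\psi(y,z)$, with $y$ a finite tuple possibly of a different length than $x$, such that $\mathcal D$ is approximable from below by $\psi(y,z)$. (No other assumption on the theory of $\mathcal U$ is made; in particular it need not be NIP.) -/

import Mathlib

open scoped FirstOrder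

universe u v w

namespace Approx

/-- The power `B ^ n`: the `n`-tuples all of whose entries lie in `B`. -/
def power {U : Type w} (B : Set U) (n : ℕ) : Set (Fin n → U) :=
  {a | ∀ i, a i ∈ B}

/-- The set `φ(b, U) = {a : U ⊨ φ(b, a)}` defined by the instance `φ(b, z)` of a formula `φ(x, z)`,
where `x` is an `m`-tuple and `z` an `n`-tuple of variables. -/
def instanceSet {L : FirstOrder.Language.{u, v}} {U : Type w} [L.Structure U] {m n : ℕ}
    (φ : L.Formula (Fin m ⊕ Fin n)) (b : Fin m → U) : Set (Fin n → U) :=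
  {a | φ.Realize (Sum.elim b a)}

/-- `D` is approximable by `φ(x, z)`: for every finite `B ⊆ U` there is a tuple `b` with
`φ(b, B) = D ∩ B ^ |z|`. -/
def ApproximableBy {L : FirstOrder.Language.{u, v}} {U : Type w} [L.Structure U] {m n : ℕ}
    (D : Set (Fin n → U)) (φ : L.Formula (Fin m ⊕ Fin n)) : Prop :=
  ∀ B : Set U, B.Finite → ∃ b : Fin m → U,
    instanceSet φ b ∩ power B n = D ∩ power B n

/-- `D` is approximable from below by `φ(x, z)`: for every finite `B ⊆ U` there is a tuple `b` with
`φ(b, B) = D ∩ B ^ |z|` and `φ(b, U) ⊆ D`. -/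
def ApproximableFromBelowBy {L : FirstOrder.Language.{u, v}} {U : Type w} [L.Structure U] {m n : ℕ}
    (D : Set (Fin n → U)) (φ : L.Formula (Fin m ⊕ Fin n)) : Prop :=
  ∀ B : Set U, B.Finite → ∃ b : Fin m → U,
    instanceSet φ b ∩ power B n = D ∩ power B n ∧ instanceSet φ b ⊆ D

/-- `D` is approximable from below: it is so by some formula `ψ(y, z)` of the language (without
parameters), with `y` a finite tuple of any length. -/
def ApproximableFromBelow (L : FirstOrder.Language.{u, v}) {U : Type w} [L.Structure U] {n : ℕ}
    (D : Set (Fin n → U)) : Prop :=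
  ∃ (k : ℕ) (ψ : L.Formula (Fin k ⊕ Fin n)), ApproximableFromBelowBy D ψ

/-- A family `F` of subsets of `X` shatters `B ⊆ X` if every subset of `B` is the trace on `B` of
some member of `F`. -/
def Shatters {X : Type w} (F : Set (Set X)) (B : Set X) : Prop :=
  ∀ H : Set X, H ⊆ B → ∃ C ∈ F, C ∩ B = H

/-- `F` has finite VC-dimension: for some `d`, no set of size `d` is shattered by `F`. -/
def FiniteVCDim {X : Type w} (F : Set (Set X)) : Prop :=
  ∃ d : ℕ, ∀ B : Finset X, B.card = d → ¬ Shatters F (B : Set X)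

/-- `φ(x, z)` is NIP in `U`: the family of the sets `φ(a, U)` has finite VC-dimension. -/
def IsNIP {L : FirstOrder.Language.{u, v}} (U : Type w) [L.Structure U] {m n : ℕ}
    (φ : L.Formula (Fin m ⊕ Fin n)) : Prop :=
  FiniteVCDim (Set.range fun a : Fin m → U => instanceSet φ a)

/-- `U` is saturated: every type `p(x)` in finitely many variables over a set of parameters
`A ⊆ U` of cardinality less than `|U|` which is finitely satisfiable in `U` is realized in `U`. -/
def IsSaturated (L : FirstOrder.Language.{u, v}) (U : Type w) [L.Structure U] : Prop :=
  ∀ A : Set U, Cardinal.mk A < Cardinal.mk U →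
    ∀ (k : ℕ) (p : Set (L[[A]].Formula (Fin k))),
      (∀ q ⊆ p, q.Finite → ∃ a : Fin k → U, ∀ θ ∈ q, θ.Realize a) →
        ∃ a : Fin k → U, ∀ θ ∈ p, θ.Realize a

end Approx

namespace Approx

open FirstOrder FirstOrder.Language Filter

variable {L : FirstOrder.Language.{u, v}} {U : Type w} [L.Structure U]

/-! The subsets of `D` or beyond that are approximable from inside `D` by one formula form an ideal.
If `D` is not in it, some ultrafilter `p` containing `D` avoids the ideal. Then a formula true of
`p`-almost all `j`-tuples cannot control membership in `D`: it has solutions with every trace on `D`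
(`exists_realize_with_trace`). Since `D` is approximable by `φ`, the trace of `D` on any tuple is
also the trace of an instance of `φ`. Hence no pattern can be omitted by `φ` on almost all
`d`-tuples. As there are finitely many patterns, one `d`-tuple carries them all, for every `d`,
against NIP. -/

/-- A formula depends on finitely many of its parameter variables. -/
theorem exists_fin_parameters {α : Type*} {β : Type*} (ψ : L.Formula (α ⊕ β)) :
    ∃ (k : ℕ) (θ : L.Formula (Fin k ⊕ β)) (e : Fin k → α),
      ∀ (d : α → U) (a : β → U),
        θ.Realize (Sum.elim (d ∘ e) a) ↔ ψ.Realize (Sum.elim d a) := by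
  classical
  let s : Finset α := ψ.freeVarFinset.toLeft
  let f : ψ.freeVarFinset → Fin s.card ⊕ β := fun x =>
    match x with
    | ⟨Sum.inl a, h⟩ => Sum.inl (s.equivFin ⟨a, Finset.mem_toLeft.2 h⟩)
    | ⟨Sum.inr b, _⟩ => Sum.inr b
  refine ⟨s.card, ψ.restrictFreeVar f, fun i => (s.equivFin.symm i : α), fun d a => ?_⟩
  refine BoundedFormula.realize_restrictFreeVar _ ?_
  rintro ⟨x | x, h⟩ <;> simp [f]

/-- `P` can be approximated from inside `D` by instances of a single formula: every finite subset
of `P` lies in an instance that is contained in `D`. -/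
def InnerApproximable (L : FirstOrder.Language.{u, v}) {U : Type w} [L.Structure U] {n : ℕ}
    (D P : Set (Fin n → U)) : Prop :=
  ∃ (k : ℕ) (ψ : L.Formula (Fin k ⊕ Fin n)), ∀ S : Set (Fin n → U), S.Finite → S ⊆ P →
    ∃ b : Fin k → U, S ⊆ instanceSet ψ b ∧ instanceSet ψ b ⊆ D

namespace InnerApproximable

variable {n : ℕ} {D P Q : Set (Fin n → U)}

/-- Lets `α` be infinite, so that all of `U` can be available as parameters; only those occurring in
`ψ` matter. -/
theorem of_formula {α : Type*} (ψ : L.Formula (α ⊕ Fin n))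
    (h : ∀ S : Set (Fin n → U), S.Finite → S ⊆ P → ∃ d : α → U,
      (∀ a ∈ S, ψ.Realize (Sum.elim d a)) ∧ ∀ a, ψ.Realize (Sum.elim d a) → a ∈ D) :
    InnerApproximable L D P := by
  obtain ⟨k, θ, e, hθ⟩ := exists_fin_parameters (U := U) ψ
  refine ⟨k, θ, fun S hS hSP => ?_⟩
  obtain ⟨d, h₁, h₂⟩ := h S hS hSP
  exact ⟨d ∘ e, fun a ha => (hθ d a).2 (h₁ a ha), fun a ha => h₂ a ((hθ d a).1 ha)⟩

theorem mono (h : InnerApproximable L D Q) (hPQ : P ⊆ Q) : InnerApproximable L D P := by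
  obtain ⟨k, ψ, h⟩ := h
  exact ⟨k, ψ, fun S hS hSP => h S hS (hSP.trans hPQ)⟩

theorem empty : InnerApproximable L D ∅ := by
  refine ⟨0, ⊥, fun S _ hS => ⟨Fin.elim0, hS.trans (Set.empty_subset _), fun a ha => ?_⟩⟩
  simp [instanceSet] at ha

/-- The disjunction of an instance covering `S ∩ P` and one covering `S ∩ Q` covers `S` and stays
inside `D`. -/
theorem union (hP : InnerApproximable L D P) (hQ : InnerApproximable L D Q) :
    InnerApproximable L D (P ∪ Q) := by
  obtain ⟨k, ψ, hP⟩ := hP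
  obtain ⟨l, θ, hQ⟩ := hQ
  refine of_formula (α := Fin k ⊕ Fin l)
    (ψ.relabel (Sum.map Sum.inl id) ⊔ θ.relabel (Sum.map Sum.inr id)) fun S hS hSPQ => ?_
  obtain ⟨b, hb, hbD⟩ := hP (S ∩ P) (hS.inter_of_left _) Set.inter_subset_right
  obtain ⟨c, hc, hcD⟩ := hQ (S ∩ Q) (hS.inter_of_left _) Set.inter_subset_right
  have key (a : Fin n → U) : (ψ.relabel (Sum.map Sum.inl id) ⊔
      θ.relabel (Sum.map Sum.inr id) : L.Formula ((Fin k ⊕ Fin l) ⊕ Fin n)).Realize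
        (Sum.elim (Sum.elim b c) a) ↔ a ∈ instanceSet ψ b ∨ a ∈ instanceSet θ c := by
    simp [instanceSet, Formula.realize_sup, Formula.realize_relabel, Sum.elim_comp_map]
  refine ⟨Sum.elim b c, fun a ha => (key a).2 ?_, fun a ha => ?_⟩
  · exact (hSPQ ha).imp (fun h => hb ⟨ha, h⟩) fun h => hc ⟨ha, h⟩
  · exact ((key a).1 ha).elim (fun h => hbD h) fun h => hcD h

theorem approximableFromBelow (h : InnerApproximable L D D) : ApproximableFromBelow L D := by
  obtain ⟨k, ψ, h⟩ := h
  refine ⟨k, ψ, fun B hB => ?_⟩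
  have hfin : (power B n).Finite := by
    simpa [power, Set.pi] using Set.Finite.pi' fun _ : Fin n => hB
  obtain ⟨b, hb, hbD⟩ := h (D ∩ power B n) (hfin.inter_of_right _) Set.inter_subset_left
  exact ⟨b, Set.Subset.antisymm (fun a ha => ⟨hbD ha.1, ha.2⟩) fun a ha => ⟨hb ha, ha.2⟩, hbD⟩

end InnerApproximable

/-- If `D` is not approximable from inside itself, some ultrafilter on `D` contains no set
approximable from inside `D`. -/
theorem exists_ultrafilter_not_innerApproximable {n : ℕ} {D : Set (Fin n → U)}
    (h : ¬ InnerApproximable L D D) :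
    ∃ p : Ultrafilter (Fin n → U), D ∈ p ∧ ∀ P ∈ p, ¬ InnerApproximable L D P := by
  -- The dual filter of the ideal; it is compatible with `D` exactly because `D` is not in the
  -- ideal.
  let F : Filter (Fin n → U) := Filter.comk (InnerApproximable L D) .empty
    (fun _ ht _ hst => ht.mono hst) fun _ hs _ ht => hs.union ht
  have hF : (F ⊓ 𝓟 D).NeBot := by
    rw [Filter.neBot_iff, Ne, Filter.inf_principal_eq_bot, Filter.mem_comk, _root_.compl_compl]
    exact h
  obtain ⟨p, hp⟩ := Ultrafilter.exists_le (F ⊓ 𝓟 D)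
  refine ⟨p, hp (Filter.mem_inf_of_right (Filter.mem_principal_self D)), fun P hP hPD => ?_⟩
  have : Pᶜ ∈ p := hp (Filter.mem_inf_of_left (by rwa [Filter.mem_comk, _root_.compl_compl]))
  exact Ultrafilter.compl_notMem_iff.2 hP this

/-- The iterated Fubini power of an ultrafilter, with the first coordinate outermost. -/
def ultrafilterPower {X : Type*} (p : Ultrafilter X) : (j : ℕ) → Ultrafilter (Fin j → X)
  | 0 => pure Fin.elim0
  | j + 1 => p.bind fun a => (ultrafilterPower p j).map (Fin.cons a)

theorem eventually_ultrafilterPower_succ {X : Type*} (p : Ultrafilter X) (j : ℕ)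
    (R : (Fin (j + 1) → X) → Prop) :
    (∀ᶠ v in ultrafilterPower p (j + 1), R v) ↔
      ∀ᶠ a in p, ∀ᶠ v in ultrafilterPower p j, R (Fin.cons a v) :=
  Iff.rfl

/-- If no set in `p` is approximable from inside `D`, then every formula which holds for almost all
`j`-tuples is satisfied by `j`-tuples having any prescribed trace on `D`. -/
theorem exists_realize_with_trace {n : ℕ} {D : Set (Fin n → U)} {p : Ultrafilter (Fin n → U)}
    (hD : D ∈ p) (hp : ∀ P ∈ p, ¬ InnerApproximable L D P) :
    ∀ (j : ℕ) (σ : Fin j → Prop) (ρ : L.Formula (U ⊕ Fin j × Fin n)),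
      (∀ᶠ v : Fin j → Fin n → U in (ultrafilterPower p j : Filter _),
          ρ.Realize (Sum.elim id fun q => v q.1 q.2)) →
        ∃ v : Fin j → Fin n → U, (∀ i, v i ∈ D ↔ σ i) ∧
          ρ.Realize (Sum.elim id fun q => v q.1 q.2)
  | 0, σ, ρ, h => ⟨Fin.elim0, fun i => i.elim0, h⟩
  | j + 1, σ, ρ, h => by
    rw [eventually_ultrafilterPower_succ] at h
    let slice (a : Fin n → U) : L.Formula (U ⊕ Fin j × Fin n) :=
      ρ.relabel (Sum.elim Sum.inl fun q =>
        Fin.cases (Sum.inl (a q.2)) (fun i => Sum.inr (i, q.2)) q.1)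
    have hslice (a : Fin n → U) (v : Fin j → Fin n → U) :
        (slice a).Realize (Sum.elim id fun q => v q.1 q.2) ↔
          ρ.Realize (Sum.elim id fun q => (Fin.cons a v : Fin (j + 1) → Fin n → U) q.1 q.2) := by
      rw [Formula.realize_relabel]
      refine iff_of_eq (congrArg _ (funext ?_))
      rintro (x | ⟨i, t⟩)
      · rfl
      · cases i using Fin.cases <;> rfl
    set P : Set (Fin n → U) := {a | ∀ᶠ v in ultrafilterPower p j,
      ρ.Realize (Sum.elim id fun q => (Fin.cons a v : Fin (j + 1) → Fin n → U) q.1 q.2)} with hPdef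
    have hP : P ∈ p := h
    suffices ∃ (a : Fin n → U) (v : Fin j → Fin n → U), (a ∈ D ↔ σ 0) ∧
        (∀ i, v i ∈ D ↔ σ i.succ) ∧
        ρ.Realize (Sum.elim id fun q => (Fin.cons a v : Fin (j + 1) → Fin n → U) q.1 q.2) by
      obtain ⟨a, v, ha, hv, hρ⟩ := this
      exact ⟨Fin.cons a v, fun i => Fin.cases ha hv i, hρ⟩
    by_cases h0 : σ 0
    · obtain ⟨a, haP, haD⟩ := p.nonempty_of_mem (Filter.inter_mem hP hD)
      obtain ⟨v, hv, hρ⟩ := exists_realize_with_trace hD hp j (fun i => σ i.succ) (slice a)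
        (Filter.Eventually.mono haP fun v hv => (hslice a v).2 hv)
      exact ⟨a, v, by simp [haD, h0], hv, (hslice a v).1 hρ⟩
    -- The tail `v` becomes the parameters of `θ`, which does not depend on the finite set `S`
    -- below.
    · let θ : L.Formula ((U ⊕ Fin j × Fin n) ⊕ Fin n) :=
        ρ.relabel (Sum.elim (Sum.inl ∘ Sum.inl) fun q =>
          Fin.cases (Sum.inr q.2) (fun i => Sum.inl (Sum.inr (i, q.2))) q.1)
      have hθ (a : Fin n → U) (v : Fin j → Fin n → U) :
          θ.Realize (Sum.elim (Sum.elim id fun q => v q.1 q.2) a) ↔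
            ρ.Realize
              (Sum.elim id fun q => (Fin.cons a v : Fin (j + 1) → Fin n → U) q.1 q.2) := by
        rw [Formula.realize_relabel]
        refine iff_of_eq (congrArg _ (funext ?_))
        rintro (x | ⟨i, t⟩)
        · rfl
        · cases i using Fin.cases <;> rfl
      by_contra hcon
      -- If no solution starts outside `D`, then for each tail `v` with the prescribed trace `ρ(·,
      -- v)` defines a subset of `D`. A tail that works for all of `S` at once would put `P` in the
      -- ideal.
      refine hp P hP (.of_formula θ fun S hS hSP => ?_)
      have : Finite S := hS
      obtain ⟨v, hv, hρ⟩ := exists_realize_with_trace hD hp j (fun i => σ i.succ)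
        (Formula.iInf fun a : S => slice a) <| by
          simp only [Formula.realize_iInf, hslice]
          exact Filter.eventually_all.2 fun a => hSP a.2
      simp only [Formula.realize_iInf, hslice] at hρ
      refine ⟨Sum.elim id fun q => v q.1 q.2, fun a ha => (hθ a v).2 (hρ ⟨a, ha⟩), fun a ha => ?_⟩
      by_contra haD
      exact hcon ⟨a, v, by simp [haD, h0], hv, (hθ a v).1 ha⟩

/-- The formula saying that the trace of some instance of `φ` on a `d`-tuple of `n`-tuples is the
one prescribed by `σ`. -/
theorem exists_trace_formula {m n d : ℕ} (φ : L.Formula (Fin m ⊕ Fin n)) (σ : Fin d → Prop) :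
    ∃ χ : L.Formula (U ⊕ Fin d × Fin n), ∀ v : Fin d → Fin n → U,
      χ.Realize (Sum.elim id fun q => v q.1 q.2) ↔ ∃ b, ∀ i, v i ∈ instanceSet φ b ↔ σ i := by
  classical
  let φ' (i : Fin d) : L.Formula ((U ⊕ Fin d × Fin n) ⊕ Fin m) :=
    φ.relabel (Sum.elim Sum.inr fun t => Sum.inl (Sum.inr (i, t)))
  have hφ' (v : Fin d → Fin n → U) (b : Fin m → U) (i : Fin d) :
      (φ' i).Realize (Sum.elim (Sum.elim id fun q => v q.1 q.2) b) ↔ v i ∈ instanceSet φ b := by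
    rw [Formula.realize_relabel]
    refine iff_of_eq (congrArg _ (funext ?_))
    rintro (x | x) <;> rfl
  refine ⟨(Formula.iInf fun i => if σ i then φ' i else (φ' i).not).iExs (Fin m), fun v => ?_⟩
  rw [Formula.realize_iExs]
  refine exists_congr fun b => ?_
  rw [Formula.realize_iInf]
  refine forall_congr' fun i => ?_
  by_cases hi : σ i <;> simp [hi, hφ', Formula.realize_not]

/-- A formula that approximates `D` traces on every tuple the pattern that `D` traces. -/
theorem ApproximableBy.exists_trace {m n d : ℕ} {D : Set (Fin n → U)}
    {φ : L.Formula (Fin m ⊕ Fin n)} (h : ApproximableBy D φ) (v : Fin d → Fin n → U) :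
    ∃ b, ∀ i, v i ∈ instanceSet φ b ↔ v i ∈ D := by
  obtain ⟨b, hb⟩ := h (Set.range fun q : Fin d × Fin n => v q.1 q.2) (Set.finite_range _)
  refine ⟨b, fun i => ?_⟩
  have hi : v i ∈ power (Set.range fun q : Fin d × Fin n => v q.1 q.2) n := fun t => ⟨(i, t), rfl⟩
  simpa [hi] using Set.ext_iff.1 hb (v i)

/-- A formula of which all patterns are traced on some `d`-tuple shatters a set of size `d`. -/
theorem exists_shatters_of_traces {X : Type w} {F : Set (Set X)} {d : ℕ} (v : Fin d → X)
    (h : ∀ σ : Fin d → Prop, ∃ C ∈ F, ∀ i, v i ∈ C ↔ σ i) :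
    ∃ B : Finset X, B.card = d ∧ Shatters F (B : Set X) := by
  classical
  -- The pattern true only at `i` separates `v i` from the other entries.
  have hinj : Function.Injective v := fun i i' hii => by
    obtain ⟨C, -, hC⟩ := h (· = i)
    exact ((hC i').1 (hii ▸ (hC i).2 rfl)).symm
  refine ⟨Finset.univ.image v, by simp [Finset.card_image_of_injective _ hinj], fun H hH => ?_⟩
  obtain ⟨C, hCF, hC⟩ := h fun i => v i ∈ H
  refine ⟨C, hCF, Set.ext fun x => ⟨?_, fun hx => ?_⟩⟩
  · rintro ⟨hxC, hx⟩
    obtain ⟨i, rfl⟩ : ∃ i, v i = x := by simpa using hx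
    exact (hC i).1 hxC
  · have hx' := hH hx
    obtain ⟨i, rfl⟩ : ∃ i, v i = x := by simpa using hx'
    exact ⟨(hC i).2 hx, hx'⟩

theorem ApproximableBy.approximableFromBelow {m n : ℕ} {D : Set (Fin n → U)}
    {φ : L.Formula (Fin m ⊕ Fin n)} (hD : ApproximableBy D φ) (hφ : IsNIP U φ) :
    ApproximableFromBelow L D := by
  refine InnerApproximable.approximableFromBelow ?_
  by_contra hcon
  obtain ⟨p, hDp, hp⟩ := exists_ultrafilter_not_innerApproximable hcon
  obtain ⟨d, hd⟩ := hφ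
  have key (σ : Fin d → Prop) :
      ∀ᶠ v : Fin d → Fin n → U in (ultrafilterPower p d : Filter _),
        ∃ b, ∀ i, v i ∈ instanceSet φ b ↔ σ i := by
    obtain ⟨χ, hχ⟩ := exists_trace_formula (U := U) φ σ
    -- Otherwise almost all tuples omit `σ`, so one of them has trace `σ` on `D`; but `φ` copies
    -- that trace.
    by_contra hσ
    rw [← Ultrafilter.eventually_not] at hσ
    obtain ⟨v, hv, hnot⟩ := exists_realize_with_trace hDp hp d σ χ.not
      (hσ.mono fun v hv => by rwa [Formula.realize_not, hχ])
    rw [Formula.realize_not, hχ] at hnot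
    obtain ⟨b, hb⟩ := hD.exists_trace v
    exact hnot ⟨b, fun i => (hb i).trans (hv i)⟩
  obtain ⟨v, hv⟩ := (Filter.eventually_all.2 key).exists
  obtain ⟨B, hB, hsh⟩ := exists_shatters_of_traces (F := Set.range fun a => instanceSet φ a) v
    fun σ => (hv σ).elim fun b hb => ⟨_, ⟨b, rfl⟩, hb⟩
  exact hd B hB hsh

end Approx

theorem mainTheorem4 {L : FirstOrder.Language.{u, v}} {U : Type w} [L.Structure U]
    (hU : Approx.IsSaturated L U)
    (hκ : (Cardinal.mk U).IsInaccessible)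
    (hL : Cardinal.lift.{w} L.card < Cardinal.lift.{max u v} (Cardinal.mk U))
    {m n : ℕ} (D : Set (Fin n → U)) (φ : L.Formula (Fin m ⊕ Fin n))
    (hφ : Approx.IsNIP U φ) (hD : Approx.ApproximableBy D φ) :
    Approx.ApproximableFromBelow L D :=
  hD.approximableFromBelow hφ
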